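/- Let $K$ be a field of characteristic zero (for example $\mathbf{C}$), let $V$ be a finite-dimensional vector space over $K$, let $n$ be a positive integer and let $\lambda$ be a partition of $n$. Let $\chi^\lambda$ be the irreducible character of the symmetric group $\mathfrak{S}_n$ corresponding to $\lambda$, and let $T_\lambda$ be the endomorphism of $V^{\otimes n}$, written on the right, given by \[ (v_1\otimes\dots\otimes v_n)\,T_\lambda=\frac{\chi^\lambda(1)}{n!}\sum_{\sigma\in\mathfrak{S}_n}\chi^\lambda(\sigma)\,v_{\sigma(1)}\otimes\dots\otimes v_{\sigma(n)} . \] A tableau of shape $\lambda$ is a filling of the boxes of the Young diagram of $\lambda$ with the numbers $1,2,\dots,n$, each used exactly once. The character $\chi^\lambda$ is normalized as usual: it is the character of the right ideal of the group algebra $K\mathfrak{S}_n$ generated by $b_Ta_T$, where $T$ is any tableau of shape $\lambda$, $a_T=\sum_{\sigma\in\operatorname{Row}(T)}\sigma$, $b_T=\sum_{\sigma\in\operatorname{Col}(T)}\operatorname{sign}(\sigma)\,\sigma$, and $\operatorname{Row}(T)$, $\operatorname{Col}(T)$ are the subgroups of $\mathfrak{S}_n$ that stabilize each row, respectively each column,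 of $T$. **Corollary (Gamas).** Let $v_1,\dots,v_n\in V$. The symmetrized tensor $(v_1\otimes\dots\otimes v_n)\,T_\lambda$ is nonzero if and only if there is a tableau of shape $\lambda$ such that, for each of its columns $C$, the family of vectors $(v_i)_{i\in C}$ is linearly independent. -/

import Mathlib

open scoped TensorProduct

noncomputable section

namespace Gamas

/-- The Young diagram of a partition of `n`: the rows are the parts in weakly decreasing order. -/
def diagram {n : ℕ} (lam : n.Partition) : YoungDiagram :=
  YoungDiagram.ofRowLens (lam.parts.sort (· ≥ ·)) (Multiset.pairwise_sort _ _).sortedGE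

theorem card_cellsOfRowLens (w : List ℕ) :
    (YoungDiagram.cellsOfRowLens w).card = w.sum := by
  induction w with
  | nil => simp [YoungDiagram.cellsOfRowLens]
  | cons a w ih =>
    rw [YoungDiagram.cellsOfRowLens, Finset.card_union_of_disjoint]
    · simp [ih]
    · rw [Finset.disjoint_left]
      rintro ⟨i, j⟩ h1 h2
      simp at h1 h2
      omega

theorem card_diagram {n : ℕ} (lam : n.Partition) : (diagram lam).cells.card = n := by
  have h : (lam.parts.sort (· ≥ ·)).sum = n := by
    rw [← Multiset.sum_coe, Multiset.sort_eq, lam.parts_sum]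
  exact (card_cellsOfRowLens _).trans h

/-- A tableau of shape `lam`: a filling of the boxes of the Young diagram of `lam` with the
numbers `1, …, n` (here `Fin n`), each number being used exactly once. No monotonicity is
required. The box `(i, j)` lies in row `i` and column `j`. -/
abbrev Tableau {n : ℕ} (lam : n.Partition) : Type :=
  {c : ℕ × ℕ // c ∈ (diagram lam).cells} ≃ Fin n

variable {n : ℕ} {lam : n.Partition}

/-- The index of the row of `T` which contains the number `k`. -/
def rowOf (T : Tableau lam) (k : Fin n) : ℕ := (T.symm k).1.1

/-- The index of the column of `T` which contains the number `k`. -/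
def colOf (T : Tableau lam) (k : Fin n) : ℕ := (T.symm k).1.2

/-- The permutations which stabilize each row of `T`. -/
def rowGroup (T : Tableau lam) : Subgroup (Equiv.Perm (Fin n)) where
  carrier := {σ | ∀ k, rowOf T (σ k) = rowOf T k}
  mul_mem' := fun {σ τ} hσ hτ k => by
    rw [Equiv.Perm.mul_apply]
    exact (hσ (τ k)).trans (hτ k)
  one_mem' := fun _ => rfl
  inv_mem' := fun {σ} hσ k => by
    have h := hσ (σ⁻¹ k)
    simp only [Equiv.Perm.inv_def, Equiv.apply_symm_apply] at h
    exact h.symm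

/-- The permutations which stabilize each column of `T`. -/
def colGroup (T : Tableau lam) : Subgroup (Equiv.Perm (Fin n)) where
  carrier := {σ | ∀ k, colOf T (σ k) = colOf T k}
  mul_mem' := fun {σ τ} hσ hτ k => by
    rw [Equiv.Perm.mul_apply]
    exact (hσ (τ k)).trans (hτ k)
  one_mem' := fun _ => rfl
  inv_mem' := fun {σ} hσ k => by
    have h := hσ (σ⁻¹ k)
    simp only [Equiv.Perm.inv_def, Equiv.apply_symm_apply] at h
    exact h.symm

theorem mem_rowGroup {T : Tableau lam} {σ : Equiv.Perm (Fin n)} :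
    σ ∈ rowGroup T ↔ ∀ k, rowOf T (σ k) = rowOf T k := Iff.rfl

theorem mem_colGroup {T : Tableau lam} {σ : Equiv.Perm (Fin n)} :
    σ ∈ colGroup T ↔ ∀ k, colOf T (σ k) = colOf T k := Iff.rfl

/-- The group algebra of the symmetric group. -/
abbrev GroupAlg (K : Type*) [Field K] (n : ℕ) := MonoidAlgebra K (Equiv.Perm (Fin n))

variable (K : Type*) [Field K]

open Classical in
/-- The row symmetrizer `a_T`. -/
def rowSymmetrizer (T : Tableau lam) : GroupAlg K n :=
  ∑ σ : Equiv.Perm (Fin n) with σ ∈ rowGroup T, MonoidAlgebra.single σ (1 : K)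

open Classical in
/-- The column antisymmetrizer `b_T`. -/
def colAntisymmetrizer (T : Tableau lam) : GroupAlg K n :=
  ∑ σ : Equiv.Perm (Fin n) with σ ∈ colGroup T,
    MonoidAlgebra.single σ (((Equiv.Perm.sign σ : ℤ) : K))

/-- The Young symmetrizer `c_T = b_T a_T`. -/
def youngSymmetrizer (T : Tableau lam) : GroupAlg K n :=
  colAntisymmetrizer K T * rowSymmetrizer K T

variable {K}

/-- The right ideal `c K[S_n]`, as a `K`-subspace of the group algebra. -/
def rightIdeal (c : GroupAlg K n) : Submodule K (GroupAlg K n) :=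
  LinearMap.range (LinearMap.mulLeft K c)

theorem mul_single_mem_rightIdeal (c : GroupAlg K n) (σ : Equiv.Perm (Fin n)) :
    ∀ x ∈ rightIdeal c,
      LinearMap.mulRight K (MonoidAlgebra.single σ (1 : K)) x ∈ rightIdeal c := by
  rintro _ ⟨y, rfl⟩
  exact ⟨y * MonoidAlgebra.single σ 1, by simp [mul_assoc]⟩

/-- The character of the right `K[S_n]`-module `c K[S_n]`: the value at `σ` is the trace of
`x ↦ x σ` on this module. -/
def rightIdealCharacter (c : GroupAlg K n) (σ : Equiv.Perm (Fin n)) : K :=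
  LinearMap.trace K (rightIdeal c)
    ((LinearMap.mulRight K (MonoidAlgebra.single σ (1 : K))).restrict
      (mul_single_mem_rightIdeal c σ))

/-- A tableau of shape `lam`. -/
def someTableau (lam : n.Partition) : Tableau lam :=
  Finset.equivFinOfCardEq (card_diagram lam)

variable (K)

/-- The irreducible character `χ^lam` of the symmetric group, with values in the field `K` of
characteristic zero: the character of the right ideal of the group algebra generated by a Young
symmetrizer of shape `lam`. It does not depend on the tableau
(`irrCharacter_eq_rightIdealCharacter` below). -/
def irrCharacter (lam : n.Partition) (σ : Equiv.Perm (Fin n)) : K :=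
  rightIdealCharacter (youngSymmetrizer K (someTableau lam)) σ

theorem rightIdealCharacter_single_mul (π : Equiv.Perm (Fin n)) (c : GroupAlg K n)
    (σ : Equiv.Perm (Fin n)) :
    rightIdealCharacter (MonoidAlgebra.single π 1 * c * MonoidAlgebra.single π⁻¹ 1) σ
      = rightIdealCharacter c σ := by
  set u : GroupAlg K n := MonoidAlgebra.single π 1
  set w : GroupAlg K n := MonoidAlgebra.single π⁻¹ 1
  have huw : u * w = 1 := by simp [u, w, MonoidAlgebra.single_mul_single, MonoidAlgebra.one_def]
  have hwu : w * u = 1 := by simp [u, w, MonoidAlgebra.single_mul_single, MonoidAlgebra.one_def]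
  let f : rightIdeal c →ₗ[K] rightIdeal (u * c * w) :=
    (LinearMap.mulLeft K u).restrict (by
      rintro _ ⟨y, rfl⟩
      refine ⟨u * y, ?_⟩
      simp only [LinearMap.mulLeft_apply]
      calc u * c * w * (u * y) = u * c * (w * u) * y := by simp only [mul_assoc]
        _ = u * (c * y) := by rw [hwu, mul_one, mul_assoc])
  let g : rightIdeal (u * c * w) →ₗ[K] rightIdeal c :=
    (LinearMap.mulLeft K w).restrict (by
      rintro _ ⟨y, rfl⟩
      refine ⟨w * y, ?_⟩
      simp only [LinearMap.mulLeft_apply]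
      calc c * (w * y) = (w * u) * c * (w * y) := by rw [hwu, one_mul]
        _ = w * (u * c * w * y) := by simp only [mul_assoc])
  let e : rightIdeal c ≃ₗ[K] rightIdeal (u * c * w) :=
    LinearEquiv.ofLinearMap f g
      (by
        ext1 x
        apply Subtype.ext
        change u * (w * (x : GroupAlg K n)) = x
        rw [← mul_assoc, huw, one_mul])
      (by
        ext1 x
        apply Subtype.ext
        change w * (u * (x : GroupAlg K n)) = x
        rw [← mul_assoc, hwu, one_mul])
  unfold rightIdealCharacter
  rw [← LinearMap.trace_conj' _ e]
  congr 1
  ext1 x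
  apply Subtype.ext
  change (x : GroupAlg K n) * _ = u * (w * (x : GroupAlg K n) * _)
  simp only [← mul_assoc]
  rw [huw, one_mul]

theorem single_conj_sum (π : Equiv.Perm (Fin n)) (f g : Equiv.Perm (Fin n) → K)
    (h : ∀ σ, g (π * σ * π⁻¹) = f σ) :
    ∑ σ, MonoidAlgebra.single σ (g σ) =
      (MonoidAlgebra.single π 1 * (∑ σ, MonoidAlgebra.single σ (f σ)) *
        MonoidAlgebra.single π⁻¹ 1 : GroupAlg K n) := by
  rw [Finset.mul_sum, Finset.sum_mul]
  symm
  refine Fintype.sum_equiv (MulAut.conj π).toEquiv _ _ fun σ => ?_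
  simp [MonoidAlgebra.single_mul_single, h]

theorem youngSymmetrizer_conj (T : Tableau lam) (π : Equiv.Perm (Fin n)) :
    youngSymmetrizer K (T.trans π) =
      MonoidAlgebra.single π 1 * youngSymmetrizer K T * MonoidAlgebra.single π⁻¹ 1 := by
  classical
  have hr : rowSymmetrizer K (T.trans π) =
      MonoidAlgebra.single π 1 * rowSymmetrizer K T * MonoidAlgebra.single π⁻¹ 1 := by
    have key := single_conj_sum K π (fun σ => if σ ∈ rowGroup T then 1 else 0)
      (fun σ => if σ ∈ rowGroup (T.trans π) then 1 else 0) (fun σ => by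
        congr 1
        rw [mem_rowGroup, mem_rowGroup, ← π.forall_congr_right]
        simp [rowOf])
    simpa [rowSymmetrizer, Finset.sum_filter, apply_ite] using key
  have hc : colAntisymmetrizer K (T.trans π) =
      MonoidAlgebra.single π 1 * colAntisymmetrizer K T * MonoidAlgebra.single π⁻¹ 1 := by
    have key := single_conj_sum K π
      (fun σ => if σ ∈ colGroup T then ((Equiv.Perm.sign σ : ℤ) : K) else 0)
      (fun σ => if σ ∈ colGroup (T.trans π) then ((Equiv.Perm.sign σ : ℤ) : K) else 0)
      (fun σ => by
        have h1 : π * σ * π⁻¹ ∈ colGroup (T.trans π) ↔ σ ∈ colGroup T := by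
          rw [mem_colGroup, mem_colGroup, ← π.forall_congr_right]
          simp [colOf]
        have h2 : Equiv.Perm.sign (π * σ * π⁻¹) = Equiv.Perm.sign σ := by
          rw [map_mul, map_mul, map_inv, mul_right_comm, mul_inv_cancel, one_mul]
        simp only [h1, h2])
    simpa [colAntisymmetrizer, Finset.sum_filter, apply_ite] using key
  have hwu : (MonoidAlgebra.single π⁻¹ 1 * MonoidAlgebra.single π 1 : GroupAlg K n) = 1 := by
    simp [MonoidAlgebra.single_mul_single, MonoidAlgebra.one_def]
  rw [youngSymmetrizer, youngSymmetrizer, hr, hc]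
  generalize MonoidAlgebra.single π⁻¹ (1 : K) = w at *
  generalize MonoidAlgebra.single π (1 : K) = u at *
  calc u * colAntisymmetrizer K T * w * (u * rowSymmetrizer K T * w)
      = u * colAntisymmetrizer K T * (w * u) * rowSymmetrizer K T * w := by
        simp only [mul_assoc]
    _ = _ := by rw [hwu, mul_one]; simp only [mul_assoc]

/-- The character is the same for every tableau of the given shape. -/
theorem irrCharacter_eq_rightIdealCharacter (lam : n.Partition) (T : Tableau lam)
    (σ : Equiv.Perm (Fin n)) :
    irrCharacter K lam σ = rightIdealCharacter (youngSymmetrizer K T) σ := by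
  have h : T = (someTableau lam).trans ((someTableau lam).symm.trans T) := by
    ext x
    simp
  rw [h, youngSymmetrizer_conj, rightIdealCharacter_single_mul, irrCharacter]

variable (V : Type*) [AddCommGroup V] [Module K V]

/-- The right action of a permutation on `V^{⊗ n}` by permuting the tensor positions:
`v₁ ⊗ ⋯ ⊗ vₙ ↦ v_{σ(1)} ⊗ ⋯ ⊗ v_{σ(n)}`. -/
def permAction (σ : Equiv.Perm (Fin n)) :
    (⨂[K] _ : Fin n, V) →ₗ[K] (⨂[K] _ : Fin n, V) :=
  (PiTensorProduct.reindex K (fun _ : Fin n => V) σ.symm).toLinearMap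

/-- The endomorphism `T_lam` of `V^{⊗ n}`:
`(χ^lam(1) / n!) ∑_σ χ^lam(σ) σ`. -/
def symmetrizer (lam : n.Partition) :
    (⨂[K] _ : Fin n, V) →ₗ[K] (⨂[K] _ : Fin n, V) :=
  (irrCharacter K lam 1 / (n.factorial : K)) •
    ∑ σ : Equiv.Perm (Fin n), irrCharacter K lam σ • permAction K V σ

variable {V}

theorem symmetrizer_tprod (lam : n.Partition) (v : Fin n → V) :
    symmetrizer K V lam (PiTensorProduct.tprod K v) =
      (irrCharacter K lam 1 / (n.factorial : K)) •
        ∑ σ : Equiv.Perm (Fin n),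
          irrCharacter K lam σ • PiTensorProduct.tprod K (fun i => v (σ i)) := by
  simp [symmetrizer, permAction]

/-- The columns of `T` index linearly independent subsets of `(v₁, …, vₙ)`: for each column, the
family of the vectors `v_k`, with `k` an entry of the column, is linearly independent. -/
def ColumnsIndependent (T : Tableau lam) (v : Fin n → V) : Prop :=
  ∀ j : ℕ, LinearIndependent K (fun k : {k : Fin n // colOf T k = j} => v k)

end Gamas

end

/-! Up to a nonzero factor, `symmetrizer` acts as the central element z = ∑ χ(σ) σ. A multiple κz, κ
≠ 0, is the sum of the Young symmetrizers c_T = b_T a_T over all tableaux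
(`youngScalar_smul_characterSum`), and each c_T is a multiple of z c_T
(`exists_youngSymmetrizer_eq_smul`). So z kills a tensor exactly when every c_T does. Both facts
rest on c_T x c_T being a multiple of c_T, and on traces on the group algebra.

It remains to treat v c_T = (v b_T) a_T for a single T. Since v b_T is alternating in the entries of
each column, a dependent column makes it vanish. If the columns are independent, take one functional
per row in general position and multiply them over all positions. The product is invariant under row
permutations, so on v c_T it takes |Row(T)| times its value on v b_T, which is a block determinant
over the columns, nonzero by general position. -/

noncomputable section

namespace Gamas

/-! ### Combinatorics of tableaux and Young symmetrizers -/

section Symmetrizers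

variable {n : ℕ} {lam : n.Partition}

theorem rowOf_colOf_mem (T : Tableau lam) (k : Fin n) :
    (rowOf T k, colOf T k) ∈ diagram lam :=
  (T.symm k).2

theorem exists_rowOf_colOf_eq (T : Tableau lam) {i j : ℕ} (h : (i, j) ∈ diagram lam) :
    ∃ k, rowOf T k = i ∧ colOf T k = j :=
  ⟨T ⟨(i, j), h⟩, by simp [rowOf], by simp [colOf]⟩

theorem eq_of_rowOf_eq_of_colOf_eq (T : Tableau lam) {k l : Fin n}
    (hr : rowOf T k = rowOf T l) (hc : colOf T k = colOf T l) : k = l :=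
  T.symm.injective (Subtype.ext (Prod.ext hr hc))

/-- A set of boxes with the same row and column lengths as a Young diagram is contained in the
diagram. -/
theorem mem_diagram_of_injective (T : Tableau lam) (g : Equiv.Perm (Fin n))
    (hg : Function.Injective fun k => (rowOf T k, colOf T (g k))) (k : Fin n) :
    (rowOf T k, colOf T (g k)) ∈ diagram lam := by
  classical
  set D := (diagram lam).cells
  set S : Finset (ℕ × ℕ) := Finset.univ.image fun k => (rowOf T k, colOf T (g k)) with hS
  -- The weight is odd, hence never zero, and positive exactly on the diagram, so the diagram is the
  -- unique finite set of maximal weight. It is a row term minus a column term, so its sum depends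
  -- only on the row and column counts, which S shares with the diagram.
  let f : ℕ × ℕ → ℤ := fun c => 2 * ((diagram lam).rowLen c.1 : ℤ) - (2 * (c.2 : ℤ) + 1)
  have hf : ∀ c, c ∈ D ↔ 0 < f c := fun c => by
    rw [YoungDiagram.mem_cells, show c = (c.1, c.2) from rfl, YoungDiagram.mem_iff_lt_rowLen]
    simp only [f]
    omega
  have hsumD : ∑ c ∈ D, f c = ∑ k, f (rowOf T k, colOf T k) := by
    rw [← Finset.sum_coe_sort]
    exact Fintype.sum_equiv T _ _ fun c => by simp [rowOf, colOf]
  have hsumS : ∑ c ∈ S, f c = ∑ k, f (rowOf T k, colOf T (g k)) :=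
    Finset.sum_image fun _ _ _ _ h => hg h
  have hsum : ∑ c ∈ S, f c = ∑ c ∈ D, f c := by
    rw [hsumD, hsumS]
    simp only [f, Finset.sum_sub_distrib]
    congr 1
    exact Equiv.sum_comp g fun k => 2 * (colOf T k : ℤ) + 1
  have h1 := Finset.sum_inter_add_sum_sdiff S D f
  have h2 := Finset.sum_inter_add_sum_sdiff D S f
  rw [Finset.inter_comm] at h2
  have h3 : 0 ≤ ∑ c ∈ D \ S, f c := Finset.sum_nonneg fun c hc =>
    ((hf c).1 (Finset.mem_sdiff.1 hc).1).le
  by_contra hk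
  have h4 : ∑ c ∈ S \ D, f c < 0 := by
    refine Finset.sum_neg (fun c hc => ?_) ⟨(rowOf T k, colOf T (g k)), ?_⟩
    · have h5 := mt (hf c).2 (Finset.mem_sdiff.1 hc).2
      simp only [f] at h5 ⊢
      omega
    · exact Finset.mem_sdiff.2 ⟨Finset.mem_image_of_mem _ (Finset.mem_univ k), hk⟩
  omega

/-- A permutation `g` which sends any two distinct entries of a row of `T` to different columns is
the product of a column permutation and a row permutation. -/
theorem exists_eq_mul_of_injective (T : Tableau lam) (g : Equiv.Perm (Fin n))
    (hg : Function.Injective fun k => (rowOf T k, colOf T (g k))) :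
    ∃ q ∈ colGroup T, ∃ p ∈ rowGroup T, g = q * p := by
  -- `p k` is the entry of the box in the row of `k` and the column of `g k`.
  choose p hr hc using fun k => exists_rowOf_colOf_eq T (mem_diagram_of_injective T g hg k)
  have hp : Function.Injective p := fun k l h => hg (by
    change (_, _) = (_, _)
    rw [← hr, ← hc, h, hr l, hc l])
  let P : Equiv.Perm (Fin n) := Equiv.ofBijective p (Finite.injective_iff_bijective.1 hp)
  refine ⟨g * P⁻¹, fun k => ?_, P, hr, by simp⟩
  obtain ⟨l, rfl⟩ := P.surjective k
  have h : (g * P⁻¹) (P l) = g l := by simp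
  rw [h]
  exact (hc l).symm

theorem eq_one_of_mem_rowGroup_of_mem_colGroup {T : Tableau lam} {σ : Equiv.Perm (Fin n)}
    (hr : σ ∈ rowGroup T) (hc : σ ∈ colGroup T) : σ = 1 :=
  Equiv.ext fun k => eq_of_rowOf_eq_of_colOf_eq T (hr k) (hc k)

theorem swap_mem_rowGroup {T : Tableau lam} {i j : Fin n} (h : rowOf T i = rowOf T j) :
    Equiv.swap i j ∈ rowGroup T := fun k => by
  rw [Equiv.swap_apply_def]
  split_ifs with h1 h2 <;> simp_all

theorem swap_mem_colGroup {T : Tableau lam} {i j : Fin n} (h : colOf T i = colOf T j) :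
    Equiv.swap i j ∈ colGroup T := fun k => by
  rw [Equiv.swap_apply_def]
  split_ifs with h1 h2 <;> simp_all

variable (K : Type*) [Field K]

open Classical in
theorem coeff_rowSymmetrizer (T : Tableau lam) (g : Equiv.Perm (Fin n)) :
    (rowSymmetrizer K T).coeff g = if g ∈ rowGroup T then 1 else 0 := by
  simp [rowSymmetrizer, MonoidAlgebra.coeff_sum, Finsupp.finsetSum_apply, Finsupp.single_apply,
    Finset.sum_ite_eq']

open Classical in
theorem coeff_colAntisymmetrizer (T : Tableau lam) (g : Equiv.Perm (Fin n)) :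
    (colAntisymmetrizer K T).coeff g =
      if g ∈ colGroup T then ((Equiv.Perm.sign g : ℤ) : K) else 0 := by
  simp [colAntisymmetrizer, MonoidAlgebra.coeff_sum, Finsupp.finsetSum_apply,
    Finsupp.single_apply, Finset.sum_ite_eq']

theorem single_mul_colAntisymmetrizer (T : Tableau lam) {q : Equiv.Perm (Fin n)}
    (hq : q ∈ colGroup T) :
    MonoidAlgebra.single q 1 * colAntisymmetrizer K T =
      ((Equiv.Perm.sign q : ℤ) : K) • colAntisymmetrizer K T := by
  ext g
  rw [MonoidAlgebra.coeff_single_mul_apply, MonoidAlgebra.coeff_smul_apply,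
    coeff_colAntisymmetrizer, coeff_colAntisymmetrizer,
    Subgroup.mul_mem_cancel_left _ (inv_mem hq)]
  split_ifs <;> simp

theorem rowSymmetrizer_mul_single (T : Tableau lam) {p : Equiv.Perm (Fin n)}
    (hp : p ∈ rowGroup T) :
    rowSymmetrizer K T * MonoidAlgebra.single p 1 = rowSymmetrizer K T := by
  ext g
  rw [MonoidAlgebra.coeff_mul_single_apply, coeff_rowSymmetrizer, coeff_rowSymmetrizer,
    Subgroup.mul_mem_cancel_right _ (inv_mem hp), mul_one]

/-- Only q = p = 1 gives qp = 1, because the row and column groups meet trivially. -/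
theorem coeff_youngSymmetrizer_one (T : Tableau lam) :
    (youngSymmetrizer K T).coeff 1 = 1 := by
  classical
  rw [youngSymmetrizer, colAntisymmetrizer, Finset.sum_mul, MonoidAlgebra.coeff_sum,
    Finsupp.finsetSum_apply, Finset.sum_eq_single 1]
  · simp [MonoidAlgebra.coeff_single_mul_apply, coeff_rowSymmetrizer, one_mem]
  · intro q hq hq1
    rw [MonoidAlgebra.coeff_single_mul_apply, coeff_rowSymmetrizer, if_neg, mul_zero]
    intro h
    rw [mul_one, inv_mem_iff] at h
    exact hq1 (eq_one_of_mem_rowGroup_of_mem_colGroup h (Finset.mem_filter.1 hq).2)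
  · simp [one_mem]

variable {K}

theorem single_mul_youngSymmetrizer (T : Tableau lam) {q : Equiv.Perm (Fin n)}
    (hq : q ∈ colGroup T) :
    MonoidAlgebra.single q 1 * youngSymmetrizer K T =
      ((Equiv.Perm.sign q : ℤ) : K) • youngSymmetrizer K T := by
  rw [youngSymmetrizer, ← mul_assoc, single_mul_colAntisymmetrizer K T hq, smul_mul_assoc]

theorem youngSymmetrizer_mul_single (T : Tableau lam) {p : Equiv.Perm (Fin n)}
    (hp : p ∈ rowGroup T) :
    youngSymmetrizer K T * MonoidAlgebra.single p 1 = youngSymmetrizer K T := by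
  rw [youngSymmetrizer, mul_assoc, rowSymmetrizer_mul_single K T hp]

variable [CharZero K]

/-- An element of the group algebra which is antisymmetric under the column group on the left and
symmetric under the row group on the right is determined by its coefficient at `1`. -/
theorem eq_zero_of_invariant (T : Tableau lam) (z : GroupAlg K n)
    (hq : ∀ q ∈ colGroup T, MonoidAlgebra.single q 1 * z = ((Equiv.Perm.sign q : ℤ) : K) • z)
    (hp : ∀ p ∈ rowGroup T, z * MonoidAlgebra.single p 1 = z) (h1 : z.coeff 1 = 0) : z = 0 := by
  have hq' : ∀ q ∈ colGroup T, ∀ g, z.coeff (q * g) = ((Equiv.Perm.sign q : ℤ) : K) * z.coeff g :=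
    fun q hqT g => by
      have h := congrArg (fun y => y.coeff g) (hq q⁻¹ (inv_mem hqT))
      simpa [MonoidAlgebra.coeff_single_mul_apply] using h
  have hp' : ∀ p ∈ rowGroup T, ∀ g, z.coeff (g * p) = z.coeff g := fun p hpT g => by
    have h := congrArg (fun y => y.coeff g) (hp p⁻¹ (inv_mem hpT))
    simpa [MonoidAlgebra.coeff_mul_single_apply] using h
  ext g
  rw [MonoidAlgebra.coeff_zero, Finsupp.zero_apply]
  by_cases hg : Function.Injective fun k => (rowOf T k, colOf T (g k))
  · obtain ⟨q, hqT, p, hpT, rfl⟩ := exists_eq_mul_of_injective T g hg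
    have h := hq' q hqT 1
    rw [hp' p hpT]
    rwa [mul_one, h1, mul_zero] at h
  · simp only [Function.Injective, not_forall, Prod.mk.injEq] at hg
    obtain ⟨i, j, ⟨hr, hc⟩, hij⟩ := hg
    -- Here i, j share a row while g i, g j share a column. The identity g (i j) = (g i g j) g then
    -- makes the coefficient at g equal to its own negative.
    have h2 := hp' _ (swap_mem_rowGroup hr) g
    have h3 : g * Equiv.swap i j = Equiv.swap (g i) (g j) * g := Equiv.mul_swap_eq_swap_mul g i j
    rw [h3, hq' _ (swap_mem_colGroup hc), Equiv.Perm.sign_swap (g.injective.ne hij)] at h2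
    simp only [Units.val_neg, Units.val_one, Int.cast_neg, Int.cast_one, neg_mul, one_mul] at h2
    exact self_eq_neg.1 h2.symm

/-- Both sides have the column and row symmetries of c_T, and they agree at 1 because c_T has
coefficient 1 there. -/
theorem youngSymmetrizer_mul_mul (T : Tableau lam) (x : GroupAlg K n) :
    youngSymmetrizer K T * x * youngSymmetrizer K T =
      (youngSymmetrizer K T * x * youngSymmetrizer K T).coeff 1 • youngSymmetrizer K T := by
  rw [← sub_eq_zero]
  refine eq_zero_of_invariant T _ (fun q hq => ?_) (fun p hp => ?_) ?_
  · rw [mul_sub, smul_sub, mul_smul_comm, ← mul_assoc, ← mul_assoc,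
      single_mul_youngSymmetrizer T hq, smul_mul_assoc, smul_mul_assoc, smul_comm]
  · rw [sub_mul, smul_mul_assoc, mul_assoc _ _ (MonoidAlgebra.single p 1),
      youngSymmetrizer_mul_single T hp]
  · rw [MonoidAlgebra.coeff_sub, Finsupp.sub_apply, MonoidAlgebra.coeff_smul_apply,
      coeff_youngSymmetrizer_one, smul_eq_mul, mul_one, sub_self]

end Symmetrizers

/-! ### Characters as traces, and the central element -/

section Characters

variable {n : ℕ} {lam : n.Partition} {K : Type*} [Field K]

instance : FiniteDimensional K (GroupAlg K n) :=
  Module.Finite.of_basis (MonoidAlgebra.basis (Equiv.Perm (Fin n)) K)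

/-- In the basis of group elements, the diagonal entry at g is the coefficient of c g σ at g. -/
theorem trace_mul_mul_single (c : GroupAlg K n) (σ : Equiv.Perm (Fin n)) :
    LinearMap.trace K (GroupAlg K n)
        (LinearMap.mulRight K (MonoidAlgebra.single σ (1 : K)) ∘ₗ LinearMap.mulLeft K c) =
      ∑ g, c.coeff (g * σ⁻¹ * g⁻¹) := by
  classical
  rw [LinearMap.trace_eq_matrix_trace K (MonoidAlgebra.basis (Equiv.Perm (Fin n)) K),
    Matrix.trace]
  refine Finset.sum_congr rfl fun g _ => ?_
  rw [Matrix.diag_apply, LinearMap.toMatrix_apply]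
  change (c * MonoidAlgebra.basis _ K g * MonoidAlgebra.single σ 1).coeff g = _
  rw [MonoidAlgebra.basis_apply]
  simp [MonoidAlgebra.coeff_mul_single_apply]

/-- If `c² = κ c` then right multiplication by `σ` on `c K[S_n]`, multiplied by `κ`, has the same
trace as `x ↦ c x σ` on the group algebra. -/
theorem smul_rightIdealCharacter {c : GroupAlg K n} {κ : K} (hc : c * c = κ • c)
    (σ : Equiv.Perm (Fin n)) :
    κ * rightIdealCharacter c σ = ∑ g, c.coeff (g * σ⁻¹ * g⁻¹) := by
  have h1 : ∀ x, (LinearMap.mulRight K (MonoidAlgebra.single σ (1 : K)) ∘ₗ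
      LinearMap.mulLeft K c) x ∈ rightIdeal c := fun x =>
    ⟨x * MonoidAlgebra.single σ 1, by simp [mul_assoc]⟩
  -- The map has image in c K[S_n], so its trace can be taken there, where left multiplication by c
  -- is the scalar κ.
  rw [← trace_mul_mul_single, ← LinearMap.trace_restrict_eq_of_forall_mem (rightIdeal c) _ h1,
    rightIdealCharacter, ← smul_eq_mul, ← map_smul]
  congr 1
  ext1 ⟨x, y, hy⟩
  apply Subtype.ext
  subst hy
  change κ • (c * y * _) = c * (c * y) * _
  rw [← mul_assoc c c, hc, smul_mul_assoc, smul_mul_assoc]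

/-- A permutation and its inverse have the same cycle type, hence are conjugate. -/
theorem sum_coeff_conj_inv (c : GroupAlg K n) (σ : Equiv.Perm (Fin n)) :
    ∑ g, c.coeff (g * σ⁻¹ * g⁻¹) = ∑ g, c.coeff (g * σ * g⁻¹) := by
  obtain ⟨h, hh⟩ := isConj_iff.1
    (Equiv.Perm.isConj_iff_cycleType_eq.2 (Equiv.Perm.cycleType_inv σ).symm)
  rw [← hh]
  refine Fintype.sum_equiv (Equiv.mulRight h) _ _ fun g => ?_
  simp [mul_assoc]

variable (K)

/-- The element `∑ χ^lam(σ) σ` of the group algebra. -/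
def characterSum (lam : n.Partition) : GroupAlg K n :=
  ∑ σ, MonoidAlgebra.single σ (irrCharacter K lam σ)

theorem coeff_characterSum (lam : n.Partition) (σ : Equiv.Perm (Fin n)) :
    (characterSum K lam).coeff σ = irrCharacter K lam σ := by
  classical
  simp [characterSum, MonoidAlgebra.coeff_sum, Finsupp.finsetSum_apply, Finsupp.single_apply]

/-- The scalar `κ` with `c_T² = κ c_T`. -/
def youngScalar (T : Tableau lam) : K :=
  (youngSymmetrizer K T * youngSymmetrizer K T).coeff 1

variable [CharZero K]

theorem youngSymmetrizer_mul_self (T : Tableau lam) :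
    youngSymmetrizer K T * youngSymmetrizer K T = youngScalar K T • youngSymmetrizer K T := by
  simpa [youngScalar] using youngSymmetrizer_mul_mul T (1 : GroupAlg K n)

theorem youngScalar_mul_irrCharacter (T : Tableau lam) (σ : Equiv.Perm (Fin n)) :
    youngScalar K T * irrCharacter K lam σ =
      ∑ g, (youngSymmetrizer K T).coeff (g * σ * g⁻¹) := by
  rw [irrCharacter_eq_rightIdealCharacter K lam T,
    smul_rightIdealCharacter (youngSymmetrizer_mul_self K T), sum_coeff_conj_inv]

/-- At σ = 1 each of the n! summands is 1. In characteristic zero this makes both κ and χ(1)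
nonzero. -/
theorem youngScalar_mul_irrCharacter_one (T : Tableau lam) :
    youngScalar K T * irrCharacter K lam 1 = n.factorial := by
  simp [youngScalar_mul_irrCharacter, coeff_youngSymmetrizer_one, Fintype.card_perm]

theorem youngScalar_ne_zero (T : Tableau lam) : youngScalar K T ≠ 0 := fun h => by
  have h1 := youngScalar_mul_irrCharacter_one K T
  rw [h, zero_mul] at h1
  exact Nat.cast_ne_zero.2 n.factorial_ne_zero h1.symm

theorem irrCharacter_one_ne_zero (lam : n.Partition) : irrCharacter K lam 1 ≠ 0 := fun h => by
  have h1 := youngScalar_mul_irrCharacter_one K (someTableau lam)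
  rw [h, mul_zero] at h1
  exact Nat.cast_ne_zero.2 n.factorial_ne_zero h1.symm

/-- Averaging c_T over conjugation gives the character, and the conjugates of c_T are the
symmetrizers of the relabelled tableaux. -/
theorem youngScalar_smul_characterSum (T : Tableau lam) :
    youngScalar K T • characterSum K lam =
      ∑ g : Equiv.Perm (Fin n), youngSymmetrizer K (T.trans g) := by
  ext σ
  rw [MonoidAlgebra.coeff_smul_apply, coeff_characterSum, smul_eq_mul,
    youngScalar_mul_irrCharacter, MonoidAlgebra.coeff_sum, Finsupp.finsetSum_apply]
  refine Fintype.sum_equiv (Equiv.inv _) _ _ fun g => ?_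
  rw [youngSymmetrizer_conj]
  simp [MonoidAlgebra.coeff_mul_single_apply, mul_assoc]

theorem irrCharacter_conj (lam : n.Partition) (σ g : Equiv.Perm (Fin n)) :
    irrCharacter K lam (g * σ * g⁻¹) = irrCharacter K lam σ := by
  have T := someTableau lam
  refine mul_left_cancel₀ (youngScalar_ne_zero K T) ?_
  rw [youngScalar_mul_irrCharacter, youngScalar_mul_irrCharacter]
  refine Fintype.sum_equiv (Equiv.mulRight g) _ _ fun x => ?_
  simp [mul_assoc]

theorem irrCharacter_inv (lam : n.Partition) (σ : Equiv.Perm (Fin n)) :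
    irrCharacter K lam σ⁻¹ = irrCharacter K lam σ := by
  have T := someTableau lam
  refine mul_left_cancel₀ (youngScalar_ne_zero K T) ?_
  rw [youngScalar_mul_irrCharacter, youngScalar_mul_irrCharacter, sum_coeff_conj_inv]

theorem characterSum_mul_single (lam : n.Partition) (g : Equiv.Perm (Fin n)) :
    characterSum K lam * MonoidAlgebra.single g 1 =
      MonoidAlgebra.single g 1 * characterSum K lam := by
  ext σ
  rw [MonoidAlgebra.coeff_mul_single_apply, MonoidAlgebra.coeff_single_mul_apply,
    coeff_characterSum, coeff_characterSum, mul_one, one_mul, ← irrCharacter_conj K lam _ g⁻¹]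
  simp [mul_assoc]

theorem characterSum_mul_comm (lam : n.Partition) (x : GroupAlg K n) :
    characterSum K lam * x = x * characterSum K lam := by
  induction x using MonoidAlgebra.induction_linear with
  | zero => simp
  | add x y hx hy => rw [mul_add, add_mul, hx, hy]
  | single g r =>
    rw [show MonoidAlgebra.single g r = r • (MonoidAlgebra.single g 1 : GroupAlg K n) by simp,
      mul_smul_comm, smul_mul_assoc, characterSum_mul_single]

/-- The trace of `x ↦ c_T x y` on the group algebra. -/
theorem trace_mul_mul (T : Tableau lam) (y : GroupAlg K n) :
    LinearMap.trace K (GroupAlg K n)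
        (LinearMap.mulRight K y ∘ₗ LinearMap.mulLeft K (youngSymmetrizer K T)) =
      youngScalar K T * (characterSum K lam * y).coeff 1 := by
  induction y using MonoidAlgebra.induction_linear with
  | zero => simp
  | add x y hx hy =>
    rw [mul_add, MonoidAlgebra.coeff_add, Finsupp.add_apply, mul_add, ← hx, ← hy, ← map_add]
    congr 1
    exact LinearMap.ext fun z => mul_add _ _ _
  | single g r =>
    have h : LinearMap.mulRight K (MonoidAlgebra.single g r) ∘ₗ
        LinearMap.mulLeft K (youngSymmetrizer K T) =
        r • (LinearMap.mulRight K (MonoidAlgebra.single g (1 : K)) ∘ₗ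
          LinearMap.mulLeft K (youngSymmetrizer K T)) := by
      rw [show MonoidAlgebra.single g r = r • (MonoidAlgebra.single g 1 : GroupAlg K n) by simp]
      exact LinearMap.ext fun z => mul_smul_comm _ _ _
    rw [h, map_smul, trace_mul_mul_single, sum_coeff_conj_inv, ← youngScalar_mul_irrCharacter,
      MonoidAlgebra.coeff_mul_single_apply, coeff_characterSum, one_mul, irrCharacter_inv,
      smul_eq_mul]
    ring

/-- The trace of x ↦ c x c is computed twice. It is κ times the coefficient of z c at 1; and since
the map is x ↦ f(x) c with f a functional, it is also f(c), the coefficient of c³ at 1, which is κ²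
≠ 0. -/
theorem characterSum_mul_youngSymmetrizer_ne_zero (T : Tableau lam) :
    characterSum K lam * youngSymmetrizer K T ≠ 0 := fun h => by
  set c := youngSymmetrizer K T
  have h1 := trace_mul_mul K T c
  rw [h, MonoidAlgebra.coeff_zero, Finsupp.zero_apply, mul_zero] at h1
  let f : GroupAlg K n →ₗ[K] K :=
    { toFun := fun x => (c * x * c).coeff 1
      map_add' := fun x y => by simp [mul_add, add_mul]
      map_smul' := fun r x => by simp }
  have h2 : LinearMap.mulRight K c ∘ₗ LinearMap.mulLeft K c = f.smulRight c := by
    apply LinearMap.ext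
    intro x
    exact youngSymmetrizer_mul_mul T x
  rw [h2, LinearMap.trace_smulRight] at h1
  change (c * c * c).coeff 1 = 0 at h1
  rw [youngSymmetrizer_mul_self, smul_mul_assoc, youngSymmetrizer_mul_self,
    MonoidAlgebra.coeff_smul_apply, MonoidAlgebra.coeff_smul_apply,
    coeff_youngSymmetrizer_one] at h1
  simp [youngScalar_ne_zero K T] at h1

/-- The Young symmetrizer is a nonzero multiple of its product with the central element
`∑ χ^lam(σ) σ`. -/
theorem exists_youngSymmetrizer_eq_smul (T : Tableau lam) :
    ∃ r : K, youngSymmetrizer K T = r • (characterSum K lam * youngSymmetrizer K T) := by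
  have h := youngSymmetrizer_mul_mul T (characterSum K lam)
  have hκ := youngScalar_ne_zero K T
  have hne := characterSum_mul_youngSymmetrizer_ne_zero K T
  rw [← characterSum_mul_comm, mul_assoc, youngSymmetrizer_mul_self, mul_smul_comm] at h
  set l := (youngScalar K T • (characterSum K lam * youngSymmetrizer K T)).coeff 1
  have hl : l ≠ 0 := by
    intro hl
    rw [hl, zero_smul] at h
    exact (smul_ne_zero hκ hne) h
  refine ⟨l⁻¹ * youngScalar K T, ?_⟩
  rw [mul_smul, h, inv_smul_smul₀ hl]

end Characters

/-! ### The action on tensors -/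

section Tensors

variable {n : ℕ} {lam : n.Partition} {K : Type*} [Field K]

/-! ### Functionals in general position -/

section Functionals

variable {V : Type*} [AddCommGroup V] [Module K V] [FiniteDimensional K V]

/-- Functionals `φ₀, φ₁, …` in general position with respect to finitely many subspaces: the first
`dim U` of them separate the points of each subspace `U`. -/
theorem exists_dual_forall_eq_zero [CharZero K] {ι : Type*} [Finite ι] (m : ℕ)
    (U : ι → Submodule K V) (hU : ∀ i, Module.finrank K (U i) ≤ m) :
    ∃ φ : ℕ → Module.Dual K V, ∀ i, ∀ x ∈ U i,
      (∀ r < Module.finrank K (U i), φ r x = 0) → x = 0 := by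
  induction m generalizing U with
  | zero =>
    refine ⟨0, fun i x hx _ => ?_⟩
    rw [Submodule.finrank_eq_zero.1 (Nat.le_zero.1 (hU i))] at hx
    exact hx
  | succ m ih =>
    have hx : ∀ i : {i // U i ≠ ⊥}, ∃ x ∈ U i, x ≠ 0 := fun i => (Submodule.ne_bot_iff _).1 i.2
    -- A single functional can avoid vanishing on finitely many nonzero vectors, as K is infinite.
    -- Intersecting with its kernel lowers the dimension of every nonzero subspace.
    choose x hxU hx0 using hx
    obtain ⟨φ₀, hφ₀⟩ := Module.exists_dual_forall_apply_ne_zero (K := K) x hx0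
    have hlt : ∀ i, U i ≠ ⊥ →
        Module.finrank K (U i ⊓ LinearMap.ker φ₀ : Submodule K V) < Module.finrank K (U i) :=
      fun i hi => Submodule.finrank_lt_finrank_of_lt <| lt_of_le_of_ne inf_le_left fun h =>
        hφ₀ ⟨i, hi⟩ (inf_eq_left.1 h (hxU ⟨i, hi⟩))
    obtain ⟨φ, hφ⟩ := ih (fun i => U i ⊓ LinearMap.ker φ₀) fun i => by
      by_cases hi : U i = ⊥
      · rw [hi, bot_inf_eq, finrank_bot]
        exact Nat.zero_le m
      · have h1 := hlt i hi
        have h2 := hU i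
        omega
    refine ⟨fun r => Nat.casesOn r φ₀ φ, fun i y hy h => ?_⟩
    by_cases hi : U i = ⊥
    · rw [hi] at hy
      exact hy
    · have h1 := hlt i hi
      exact hφ i y ⟨hy, h 0 (by omega)⟩ fun r hr => h (r + 1) (by omega)

theorem card_column_le (T : Tableau lam) (j : ℕ) :
    Fintype.card {k : Fin n // colOf T k = j} ≤ (diagram lam).colLen j := by
  have h : ∀ k : {k : Fin n // colOf T k = j}, rowOf T k < (diagram lam).colLen j := fun k => by
    have h := YoungDiagram.mem_iff_lt_colLen.1 (rowOf_colOf_mem T k)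
    rwa [k.2] at h
  simpa using Fintype.card_le_of_injective
    (fun k : {k : Fin n // colOf T k = j} => (⟨rowOf T k, h k⟩ : Fin _)) fun k l hkl =>
      Subtype.ext (eq_of_rowOf_eq_of_colOf_eq T (Fin.mk.inj_iff.1 hkl) (k.2.trans l.2.symm))

/-- If the columns of `T` are independent, then there are functionals, one for each row, such that
the block diagonal matrix formed by their values on the columns of `T` is invertible. -/
theorem exists_dual_det_ne_zero [CharZero K] (T : Tableau lam) {v : Fin n → V}
    (hv : ColumnsIndependent K T v) :
    ∃ φ : ℕ → Module.Dual K V,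
      (Matrix.of fun l k => if colOf T l = colOf T k then φ (rowOf T k) (v l) else 0).det ≠ 0 := by
  classical
  -- Column spans are indexed by entries, which keeps the index type finite.
  let U : Fin n → Submodule K V := fun k₀ =>
    Submodule.span K (Set.range fun k : {k : Fin n // colOf T k = colOf T k₀} => v k)
  obtain ⟨φ, hφ⟩ := exists_dual_forall_eq_zero (Module.finrank K V) U
    fun i => Submodule.finrank_le _
  refine ⟨φ, fun hdet => ?_⟩
  obtain ⟨x, hx0, hx⟩ := Matrix.exists_vecMul_eq_zero_iff.2 hdet
  refine hx0 (funext fun k₀ => ?_)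
  set w : V := ∑ k : {k : Fin n // colOf T k = colOf T k₀}, x k • v k with hw
  have hwU : w ∈ U k₀ := Submodule.sum_mem _ fun k _ =>
    Submodule.smul_mem _ _ (Submodule.subset_span ⟨k, rfl⟩)
  have hw0 : w = 0 := by
    refine hφ k₀ w hwU fun r hr => ?_
    -- The span has dimension at most the column length, so row r meets this column, and the matrix
    -- column of the entry there gives φ r w = 0.
    have hr' : r < (diagram lam).colLen (colOf T k₀) :=
      hr.trans_le ((finrank_range_le_card _).trans (card_column_le T _))
    obtain ⟨k, rfl, hk⟩ := exists_rowOf_colOf_eq T (YoungDiagram.mem_iff_lt_colLen.2 hr')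
    have h := congrFun hx k
    rw [Matrix.vecMul, dotProduct, Pi.zero_apply] at h
    simp only [Matrix.of_apply, mul_ite, mul_zero] at h
    rw [hw, map_sum, ← h, hk]
    simp only [map_smul, smul_eq_mul]
    rw [← Finset.sum_filter, Finset.sum_subtype (p := fun l => colOf T l = colOf T k₀)]
    simp
  exact Fintype.linearIndependent_iff.1 (hv (colOf T k₀)) (fun k => x k) hw0 ⟨k₀, rfl⟩

end Functionals

/-! ### Right action of the group algebra and its evaluation by functionals -/

variable {V : Type*} [AddCommGroup V] [Module K V]

theorem permAction_tprod (σ : Equiv.Perm (Fin n)) (v : Fin n → V) :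
    permAction K V σ (PiTensorProduct.tprod K v) = PiTensorProduct.tprod K fun i => v (σ i) := by
  simp [permAction]

variable (K V)

/-- The right action of the group algebra on `V^{⊗ n}`. -/
def rightAction : GroupAlg K n →ₐ[K] (Module.End K (⨂[K] _ : Fin n, V))ᵐᵒᵖ :=
  MonoidAlgebra.lift K _ _
    { toFun := fun σ => MulOpposite.op (permAction K V σ)
      map_one' := by
        rw [← MulOpposite.op_one]
        congr 1
        ext v
        exact permAction_tprod 1 v
      map_mul' := fun σ τ => by
        rw [← MulOpposite.op_mul]
        congr 1
        ext v
        simp [permAction_tprod] }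

variable {K V}

/-- The tensor `(v₁ ⊗ ⋯ ⊗ vₙ) x` for `x` in the group algebra. -/
def tensorMul (x : GroupAlg K n) (v : ⨂[K] _ : Fin n, V) : ⨂[K] _ : Fin n, V :=
  (rightAction K V x).unop v

theorem tensorMul_mul (x y : GroupAlg K n) (v : ⨂[K] _ : Fin n, V) :
    tensorMul (x * y) v = tensorMul y (tensorMul x v) := by
  simp [tensorMul]

theorem tensorMul_single (σ : Equiv.Perm (Fin n)) (r : K) (v : ⨂[K] _ : Fin n, V) :
    tensorMul (MonoidAlgebra.single σ r) v = r • permAction K V σ v := by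
  simp [tensorMul, rightAction, MonoidAlgebra.lift_single]

theorem tensorMul_sum {ι : Type*} (s : Finset ι) (x : ι → GroupAlg K n) (v : ⨂[K] _ : Fin n, V) :
    tensorMul (∑ i ∈ s, x i) v = ∑ i ∈ s, tensorMul (x i) v := by
  simp [tensorMul, map_sum]

theorem tensorMul_smul (r : K) (x : GroupAlg K n) (v : ⨂[K] _ : Fin n, V) :
    tensorMul (r • x) v = r • tensorMul x v := by
  simp [tensorMul]

theorem tensorMul_zero_right (x : GroupAlg K n) :
    tensorMul x (0 : ⨂[K] _ : Fin n, V) = 0 :=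
  map_zero (rightAction K V x).unop

theorem symmetrizer_apply (lam : n.Partition) (v : ⨂[K] _ : Fin n, V) :
    symmetrizer K V lam v =
      (irrCharacter K lam 1 / (n.factorial : K)) • tensorMul (characterSum K lam) v := by
  simp [symmetrizer, characterSum, tensorMul_sum, tensorMul_single]

/-- A functional which is a product of functionals depending only on the row of `T`, evaluated on
`v b_T`. -/
theorem lift_tensorMul_colAntisymmetrizer (T : Tableau lam) (v : Fin n → V)
    (φ : ℕ → Module.Dual K V) :
    PiTensorProduct.lift ((MultilinearMap.mkPiAlgebra K (Fin n) K).compLinearMap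
        fun i => φ (rowOf T i))
      (tensorMul (colAntisymmetrizer K T) (PiTensorProduct.tprod K v)) =
      (Matrix.of fun l k => if colOf T l = colOf T k then φ (rowOf T k) (v l) else 0).det := by
  classical
  rw [colAntisymmetrizer, tensorMul_sum, map_sum, Matrix.det_apply', Finset.sum_filter]
  refine Finset.sum_congr rfl fun σ _ => ?_
  rw [tensorMul_single, map_smul, permAction_tprod, PiTensorProduct.lift.tprod]
  simp only [MultilinearMap.compLinearMap_apply, MultilinearMap.mkPiAlgebra_apply,
    Matrix.of_apply, smul_eq_mul]
  split_ifs with h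
  · simp only [mem_colGroup.1 h, if_true]
  -- In the Leibniz expansion, a permutation moving some entry out of its column meets a zero of the
  -- block matrix.
  · obtain ⟨k, hk⟩ := not_forall.1 h
    rw [Finset.prod_eq_zero (Finset.mem_univ k) (if_neg hk), mul_zero]

theorem lift_tensorMul_rowSymmetrizer (T : Tableau lam) (w : ⨂[K] _ : Fin n, V)
    (φ : ℕ → Module.Dual K V) :
    PiTensorProduct.lift ((MultilinearMap.mkPiAlgebra K (Fin n) K).compLinearMap
        fun i => φ (rowOf T i)) (tensorMul (rowSymmetrizer K T) w) =
      (Nat.card (rowGroup T) : K) *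
        PiTensorProduct.lift ((MultilinearMap.mkPiAlgebra K (Fin n) K).compLinearMap
          fun i => φ (rowOf T i)) w := by
  classical
  have h : ∀ p ∈ rowGroup T, PiTensorProduct.lift ((MultilinearMap.mkPiAlgebra K (Fin n)
      K).compLinearMap fun i => φ (rowOf T i)) ∘ₗ permAction K V p =
      PiTensorProduct.lift ((MultilinearMap.mkPiAlgebra K (Fin n) K).compLinearMap
        fun i => φ (rowOf T i)) := fun p hp => by
    ext v
    simp only [LinearMap.compMultilinearMap_apply, LinearMap.comp_apply, permAction_tprod,
      PiTensorProduct.lift.tprod, MultilinearMap.compLinearMap_apply,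
      MultilinearMap.mkPiAlgebra_apply]
    rw [← Equiv.prod_comp p fun i => φ (rowOf T i) (v i)]
    exact Finset.prod_congr rfl fun i _ => by rw [hp i]
  rw [rowSymmetrizer, tensorMul_sum, map_sum, Finset.sum_congr rfl fun p hp => by
    rw [tensorMul_single, one_smul, ← LinearMap.comp_apply, h p (Finset.mem_filter.1 hp).2],
    Finset.sum_const, nsmul_eq_mul, Nat.card_eq_fintype_card, Fintype.card_subtype]

theorem tensorMul_youngSymmetrizer_ne_zero [CharZero K] [FiniteDimensional K V] (T : Tableau lam)
    {v : Fin n → V} (hv : ColumnsIndependent K T v) :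
    tensorMul (youngSymmetrizer K T) (PiTensorProduct.tprod K v) ≠ 0 := fun h => by
  obtain ⟨φ, hφ⟩ := exists_dual_det_ne_zero T hv
  have h1 := lift_tensorMul_rowSymmetrizer T
    (tensorMul (colAntisymmetrizer K T) (PiTensorProduct.tprod K v)) φ
  rw [← tensorMul_mul, ← youngSymmetrizer, h, map_zero, lift_tensorMul_colAntisymmetrizer] at h1
  exact mul_ne_zero (Nat.cast_ne_zero.2 Nat.card_pos.ne') hφ h1.symm

/-- The transposition of k and l fixes the tensor but negates b_T, so the product equals its own
negative. -/
theorem colAntisymmetrizer_eq_zero_of_eq [CharZero K] (T : Tableau lam) {v : Fin n → V}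
    {k l : Fin n} (hkl : k ≠ l) (hc : colOf T k = colOf T l) (hv : v k = v l) :
    tensorMul (colAntisymmetrizer K T) (PiTensorProduct.tprod K v) = 0 := by
  have h := congrArg (fun x => tensorMul x (PiTensorProduct.tprod K v))
    (single_mul_colAntisymmetrizer K T (swap_mem_colGroup hc))
  rw [tensorMul_smul] at h
  have hv' : (fun i => v (Equiv.swap k l i)) = v := funext fun i => by
    rw [Equiv.swap_apply_def]
    split_ifs with h1 h2 <;> simp_all
  simp only [tensorMul_mul, tensorMul_single, one_smul, permAction_tprod,
    Equiv.Perm.sign_swap hkl, hv', Units.val_neg, Units.val_one, Int.cast_neg, Int.cast_one,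
    neg_smul, one_smul] at h
  have h2 : (2 : K) • tensorMul (colAntisymmetrizer K T) (PiTensorProduct.tprod K v) = 0 := by
    rw [two_smul]
    exact add_eq_zero_iff_eq_neg.2 h
  exact (smul_eq_zero.1 h2).resolve_left two_ne_zero

theorem columnsIndependent_of_tensorMul_ne_zero [CharZero K] (T : Tableau lam) {v : Fin n → V}
    (h : tensorMul (colAntisymmetrizer K T) (PiTensorProduct.tprod K v) ≠ 0) :
    ColumnsIndependent K T v := fun j => by
  classical
  rw [linearIndependent_iff_notMem_span]
  intro l hl
  let F := (rightAction K V (colAntisymmetrizer K T)).unop.compMultilinearMap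
    (PiTensorProduct.tprod K (s := fun _ : Fin n => V))
  -- As a linear function of the l-th slot, v b_T vanishes on the other vectors of the column, hence
  -- on their span.
  have hle : Submodule.span K ((fun k : {k : Fin n // colOf T k = j} => v k) ''
      (Set.univ \ {l})) ≤ LinearMap.ker (F.toLinearMap v l) := by
    rw [Submodule.span_le]
    rintro _ ⟨m, ⟨-, hm⟩, rfl⟩
    have hml : (m : Fin n) ≠ l := fun h => hm (Subtype.ext h)
    refine colAntisymmetrizer_eq_zero_of_eq T hml (m.2.trans l.2.symm) ?_
    rw [Function.update_of_ne hml, Function.update_self]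
  have h0 : F (Function.update v l (v l)) = 0 := hle hl
  rw [Function.update_eq_self] at h0
  exact h h0

/-- If all c_T kill v, so does their sum κz. If z kills v, so does c_T = r z c_T. -/
theorem symmetrizer_ne_zero_iff [CharZero K] (lam : n.Partition) (v : ⨂[K] _ : Fin n, V) :
    symmetrizer K V lam v ≠ 0 ↔ ∃ T : Tableau lam, tensorMul (youngSymmetrizer K T) v ≠ 0 := by
  rw [symmetrizer_apply, smul_ne_zero_iff_right (div_ne_zero (irrCharacter_one_ne_zero K lam)
    (Nat.cast_ne_zero.2 n.factorial_ne_zero))]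
  constructor
  · intro h
    by_contra! h0
    have T := someTableau lam
    refine smul_ne_zero (youngScalar_ne_zero K T) h ?_
    rw [← tensorMul_smul, youngScalar_smul_characterSum, tensorMul_sum]
    exact Finset.sum_eq_zero fun g _ => h0 _
  · rintro ⟨T, hT⟩ h
    obtain ⟨r, hr⟩ := exists_youngSymmetrizer_eq_smul K T
    rw [hr, tensorMul_smul, tensorMul_mul, h, tensorMul_zero_right, smul_zero] at hT
    exact hT rfl

end Tensors

end Gamas
end

theorem mainTheorem4 {K : Type*} [Field K] [CharZero K]
    {V : Type*} [AddCommGroup V] [Module K V] [FiniteDimensional K V]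
    {n : ℕ} (hn : 0 < n) (lam : n.Partition) (v : Fin n → V) :
    Gamas.symmetrizer K V lam (PiTensorProduct.tprod K v) ≠ 0 ↔
      ∃ T : Gamas.Tableau lam, Gamas.ColumnsIndependent K T v := by
  rw [Gamas.symmetrizer_ne_zero_iff]
  refine exists_congr fun T => ⟨fun h => ?_, Gamas.tensorMul_youngSymmetrizer_ne_zero T⟩
  -- Since v c_T = (v b_T) a_T, vanishing of v b_T would force v c_T = 0.
  refine Gamas.columnsIndependent_of_tensorMul_ne_zero T fun h0 => h ?_
  rw [Gamas.youngSymmetrizer, Gamas.tensorMul_mul, h0, Gamas.tensorMul_zero_right]
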